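/- Let $R$ be a commutative artinian ring, let $\Lambda$ and $\Gamma$ be artin $R$-algebras (that is, $R$-algebras which are finitely generated as $R$-modules), and let $I$ be a two-sided ideal of $\Gamma$ such that $\Gamma$ is a split-by-nilpotent extension of $\Lambda$ by $I$: $I\subseteq\mathrm{rad}(\Gamma)$, and there are morphisms of $R$-algebras $\pi:\Gamma\to\Lambda$ and $\sigma:\Lambda\to\Gamma$ with $\pi$ surjective, $\ker\pi=I$ and $\pi\sigma=1_\Lambda$. Regard $I$ as a $\Lambda$-$\Lambda$-bimodule via $\sigma$, and write $I\otimes-$ for $I\otimes_\Lambda-$. Let $\mathrm{mod}(\Lambda)$ be the category of finitely generated left $\Lambda$-modules. Let $\{P(i)\}_{i=1}^n$ contain exactly one module of each isomorphism class of indecomposable projective modules in $\mathrm{mod}(\Lambda)$, and let $\le$ be a linear order on $[1,n]=\{1,\dots,n\}$. Put $S(i)=P(i)/\mathrm{rad}\,P(i)$ and $\Delta(i)=P(i)/\mathrm{Tr}_{\oplus_{j>i}P(j)}(P(i))$, where $\mathrm{Tr}_M(N)$ is the submodule of $N$ generated by the images of all morphisms $M\to N$; write ${}_\Lambda S=\{S(i)\}_{i=1}^n$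 and ${}_\Lambda\Delta=\{\Delta(i)\}_{i=1}^n$. A pair $(\Theta,\le)$, with $\Theta=\{\Theta(i)\}_{i=1}^n$ a family of indecomposable modules in $\mathrm{mod}(\Lambda)$, is a *stratifying system* if $\mathrm{Hom}_\Lambda(\Theta(i),\Theta(j))=0$ for $i>j$ and $\mathrm{Ext}^1_\Lambda(\Theta(i),\Theta(j))=0$ for $i\ge j$. A stratifying system $(\Theta,\le)$ is *compatible* with $I$ if (C1) $\mathrm{Hom}_\Lambda(\Theta(j),I\otimes\Theta(i))=0$ for $j>i$, and (C2) $\mathrm{Ext}^1_\Lambda(\Theta(j),I\otimes\Theta(i))=0$ for $j\ge i$. The pair $({}_\Lambda S,\le)$ is *admissible* with $I$ if the composition multiplicity $[I\otimes S(i):S(j)]$ is $0$ for $j>i$. Finally, $\Lambda$ is *standardly stratified* (with respect to $\le$) if every finitely generated projective $\Lambda$-module has a finite filtration by submodules, from $0$ to the whole module, all of whose factors are isomorphic to modules in ${}_\Lambda\Delta$. Assume that $I$ is projective as a right $\Lambda$-module. Then $({}_\Lambda\Delta,\le)$ is a stratifying system (the canonical stratifying system), and the following hold. (a) If $({}_\Lambda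 S,\le)$ is admissible with $I$, then $({}_\Lambda\Delta,\le)$ is compatible with $I$. (b) If $\Lambda$ is standardly stratified and $({}_\Lambda\Delta,\le)$ is compatible with $I$, then $({}_\Lambda S,\le)$ is admissible with $I$. -/

import Mathlib

universe w u

section Modules

variable (A : Type u) [Ring A]

/-- The tensor product `X ⊗_A M` of an `A`-`A`-bimodule `X` and a left `A`-module `M` over the
possibly noncommutative ring `A`: the quotient of `X ⊗_ℤ M` by the relations
`(x a) ⊗ m = x ⊗ (a m)`. The set of these relations is stable under left multiplication by `A`,
so the `A`-span used here is the additive subgroup that they generate; the left `A`-module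
structure comes from the left factor: `b (x ⊗ m) = (b x) ⊗ m`. -/
abbrev BimoduleTensor (X : Type u) [AddCommGroup X] [Module A X] [Module Aᵐᵒᵖ X]
    [SMulCommClass A Aᵐᵒᵖ X] (M : Type u) [AddCommGroup M] [Module A M] : Type u :=
  TensorProduct ℤ X M ⧸ Submodule.span A
    {z : TensorProduct ℤ X M | ∃ (x : X) (a : A) (m : M),
      z = TensorProduct.tmul ℤ (MulOpposite.op a • x) m - TensorProduct.tmul ℤ x (a • m)}

/-- The trace of `M` in `N`: the submodule of `N` generated by the images of all morphisms
from `M` to `N`. -/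
def traceSubmodule (M N : Type u) [AddCommGroup M] [Module A M] [AddCommGroup N] [Module A N] :
    Submodule A N :=
  ⨆ f : M →ₗ[A] N, LinearMap.range f

/-- Indecomposability of a left `A`-module. -/
def IsIndecomposableModule (M : Type u) [AddCommGroup M] [Module A M] : Prop :=
  CategoryTheory.Indecomposable (ModuleCat.of A M)

/-- The vanishing of `Ext¹_A(M, N)`. -/
def ExtOneVanishes (M N : Type u) [AddCommGroup M] [Module A M] [AddCommGroup N] [Module A N] :
    Prop :=
  Subsingleton (CategoryTheory.Abelian.Ext (ModuleCat.of A M) (ModuleCat.of A N) 1)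

/-- The vanishing of `Hom_A(M, N)`. -/
def HomVanishes (M N : Type u) [AddCommGroup M] [Module A M] [AddCommGroup N] [Module A N] :
    Prop :=
  ∀ f : M →ₗ[A] N, f = 0

/-- The multiplicity `[M : S]` of a simple module `S` as a composition factor of a module `M` of
finite length: the number of factors isomorphic to `S` in a composition series of `M`. By the
Jordan–Hölder theorem all composition series give the same number, see
`compositionMultiplicity_eq`, so the supremum is over equal values. -/
noncomputable def compositionMultiplicity (M S : Type u) [AddCommGroup M] [Module A M]
    [AddCommGroup S] [Module A S] : ℕ∞ :=
  ⨆ (s : CompositionSeries (Submodule A M)) (_ : s.head = ⊥ ∧ s.last = ⊤),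
    Set.encard {k : Fin s.length | Nonempty
      ((↥(s k.succ) ⧸ (s k.castSucc).submoduleOf (s k.succ)) ≃ₗ[A] S)}

theorem nonempty_quotient_equiv_of_iso {M : Type u} [AddCommGroup M] [Module A M]
    {p q : Submodule A M × Submodule A M} (h : JordanHolderLattice.Iso p q) :
    Nonempty ((↥p.2 ⧸ p.1.submoduleOf p.2) ≃ₗ[A] (↥q.2 ⧸ q.1.submoduleOf q.2)) := by
  refine JordanHolderLattice.Iso.rel
    (fun (p q : Submodule A M × Submodule A M) => Nonempty ((↥p.2 ⧸ p.1.submoduleOf p.2) ≃ₗ[A] (↥q.2 ⧸ q.1.submoduleOf q.2)))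
    ⟨LinearEquiv.refl _ _⟩ (fun ⟨e⟩ => ⟨e.symm⟩) (fun ⟨e⟩ ⟨f⟩ => ⟨e.trans f⟩) ?_ h
  intro x y _
  have e := LinearMap.quotientInfEquivSupQuotient y x
  refine ⟨?_⟩
  rw [inf_comm x y, sup_comm x y]
  exact e.symm

theorem compositionMultiplicity_eq (M S : Type u) [AddCommGroup M] [Module A M]
    [AddCommGroup S] [Module A S] (s : CompositionSeries (Submodule A M))
    (hs : s.head = ⊥ ∧ s.last = ⊤) :
    compositionMultiplicity A M S = Set.encard {k : Fin s.length | Nonempty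
      ((↥(s k.succ) ⧸ (s k.castSucc).submoduleOf (s k.succ)) ≃ₗ[A] S)} := by
  unfold compositionMultiplicity
  refine le_antisymm (iSup₂_le fun t ht => ?_) (le_iSup₂_of_le s hs le_rfl)
  obtain ⟨f, hf⟩ := CompositionSeries.jordan_holder t s (ht.1.trans hs.1.symm)
    (ht.2.trans hs.2.symm)
  rw [← f.injective.encard_image]
  refine Set.encard_le_encard ?_
  rintro _ ⟨k, ⟨e⟩, rfl⟩
  obtain ⟨g⟩ := nonempty_quotient_equiv_of_iso A (hf k)
  exact ⟨g.symm.trans e⟩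

variable {ι : Type} (Θ : ι → Type u) [∀ i, AddCommGroup (Θ i)] [∀ i, Module A (Θ i)]

/-- `M` has a `Θ`-filtration `0 = M₀ ⊆ M₁ ⊆ ⋯ ⊆ Mₛ = M`: each factor `Mₖ₊₁ / Mₖ` is isomorphic to
a module in `Θ`. -/
def HasFiltration (M : Type u) [AddCommGroup M] [Module A M] : Prop :=
  ∃ (s : ℕ) (F : Fin (s + 1) → Submodule A M), F 0 = ⊥ ∧ F (Fin.last s) = ⊤ ∧
    ∀ k : Fin s, F k.castSucc ≤ F k.succ ∧
      ∃ i, Nonempty ((↥(F k.succ) ⧸ (F k.castSucc).submoduleOf (F k.succ)) ≃ₗ[A] Θ i)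

/-- The pair `(Θ, ≤)` is a stratifying system in `mod A`; the linear order is the one of the index
type. -/
structure IsStratifyingSystem [LinearOrder ι] : Prop where
  finite : ∀ i, Module.Finite A (Θ i)
  indecomposable : ∀ i, IsIndecomposableModule A (Θ i)
  hom_eq_zero : ∀ i j, j < i → HomVanishes A (Θ i) (Θ j)
  ext_eq_zero : ∀ i j, j ≤ i → ExtOneVanishes A (Θ i) (Θ j)

variable (P : ι → Type u) [∀ i, AddCommGroup (P i)] [∀ i, Module A (P i)]

/-- `P` contains exactly one module of each isomorphism class of finitely generated indecomposable
projective left `A`-modules. -/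
structure IsRepresentativeProjectives : Prop where
  finite : ∀ i, Module.Finite A (P i)
  projective : ∀ i, Module.Projective A (P i)
  indecomposable : ∀ i, IsIndecomposableModule A (P i)
  eq_of_equiv : ∀ i j, Nonempty (P i ≃ₗ[A] P j) → i = j
  exists_equiv : ∀ (Q : Type u) [AddCommGroup Q] [Module A Q], Module.Finite A Q →
    Module.Projective A Q → IsIndecomposableModule A Q → ∃ i, Nonempty (Q ≃ₗ[A] P i)

/-- The simple module `S(i) = P(i) / rad P(i)`. -/
abbrev SimpleTop (i : ι) : Type u :=
  P i ⧸ Module.jacobson A (P i)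

/-- The standard module `Δ(i)`: the quotient of `P(i)` by the trace of `⨁_{j > i} P(j)`. -/
abbrev StandardModule [LinearOrder ι] (i : ι) : Type u :=
  P i ⧸ traceSubmodule A (DirectSum (Set.Ioi i) fun j => P j) (P i)

/-- `(A, ≤)` is a standardly stratified algebra: every finitely generated projective module has a
filtration by standard modules. -/
def IsStandardlyStratified [LinearOrder ι] : Prop :=
  ∀ (Q : Type u) [AddCommGroup Q] [Module A Q], Module.Finite A Q → Module.Projective A Q →
    HasFiltration A (StandardModule A P) Q

end Modules

/-- `Γ` is a split-by-nilpotent extension of `Λ` by the two-sided ideal `I`: the ideal lies in the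
Jacobson radical, and there is an exact sequence `0 → I → Γ → Λ → 0` whose epimorphism of algebras
`π` is split by a morphism of algebras `σ`. -/
structure SplitByNilpotentExtension (R : Type w) [CommRing R] (Γ Λ : Type u) [Ring Γ] [Ring Λ]
    [Algebra R Γ] [Algebra R Λ] (I : TwoSidedIdeal Γ) where
  /-- The epimorphism onto `Λ`. -/
  π : Γ →ₐ[R] Λ
  /-- The section of `π`. -/
  σ : Λ →ₐ[R] Γ
  le_jacobson : ∀ x ∈ I, x ∈ Ring.jacobson Γ
  surjective : Function.Surjective π
  mem_iff : ∀ x, x ∈ I ↔ π x = 0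
  comp_eq_id : π.comp σ = AlgHom.id R Λ

namespace SplitByNilpotentExtension

variable {R : Type w} [CommRing R] {Γ Λ : Type u} [Ring Γ] [Ring Λ] [Algebra R Γ] [Algebra R Λ]
  {I : TwoSidedIdeal Γ}

/-- The ideal `I` as a `Λ`-`Λ`-bimodule, by restriction along `σ` of its `Γ`-`Γ`-bimodule
structure. -/
def IdealBimodule (_E : SplitByNilpotentExtension R Γ Λ I) : Type u := ↥I

variable (E : SplitByNilpotentExtension R Γ Λ I)

instance : AddCommGroup E.IdealBimodule := inferInstanceAs (AddCommGroup ↥I)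

/-- Left multiplication: `a • x = σ(a) x`. -/
instance : Module Λ E.IdealBimodule := Module.compHom (↥I) E.σ.toRingHom

/-- Right multiplication: `op a • x = x σ(a)`. -/
instance : Module Λᵐᵒᵖ E.IdealBimodule := Module.compHom (↥I) E.σ.toRingHom.op

instance : SMulCommClass Λ Λᵐᵒᵖ E.IdealBimodule where
  smul_comm a b x := smul_comm (E.σ a) (MulOpposite.op (E.σ b.unop)) (show ↥I from x)

/-- The left `Λ`-module `I ⊗_Λ M`. -/
abbrev IdealTensor (M : Type u) [AddCommGroup M] [Module Λ M] : Type u :=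
  BimoduleTensor Λ E.IdealBimodule M

/-- The conditions (C1) and (C2) for a stratifying system `(Θ, ≤)` in `mod Λ` to be compatible
with the ideal `I`. -/
structure IsCompatible {ι : Type} [LinearOrder ι] (Θ : ι → Type u) [∀ i, AddCommGroup (Θ i)]
    [∀ i, Module Λ (Θ i)] : Prop where
  hom_eq_zero : ∀ i j, i < j → HomVanishes Λ (Θ j) (E.IdealTensor (Θ i))
  ext_eq_zero : ∀ i j, i ≤ j → ExtOneVanishes Λ (Θ j) (E.IdealTensor (Θ i))

/-- The pair `(S, ≤)` is admissible with the ideal `I`: `[I ⊗ S(i) : S(j)] = 0` for `j > i`. -/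
def IsAdmissible {ι : Type} [LinearOrder ι] (S : ι → Type u) [∀ i, AddCommGroup (S i)]
    [∀ i, Module Λ (S i)] : Prop :=
  ∀ i j, i < j → compositionMultiplicity Λ (E.IdealTensor (S i)) (S j) = 0

end SplitByNilpotentExtension

/-! Everything is tested by the functors `Hom(P(j), -)`: they are exact, and for finitely generated
`M` one has `[M : S(j)] = 0` iff `Hom(P(j), M) = 0` (`compositionMultiplicity_eq_zero_iff`). Since
`I ⊗ -` is right exact, this vanishing passes through filtrations after tensoring.

For (a), `Hom(P(k), Δ(i)) = 0` for `k > i`, so all composition factors of `Δ(i)` are `S(k)` with `k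
≤ i`. Admissibility on these gives `Hom(P(j), I ⊗ Δ(i)) = 0` for `j > i`
(`homVanishes_bimoduleTensor`). (C1) follows as `Δ(j)` is a quotient of `P(j)`. For (C2),
`Ext¹(Δ(j), X)` is a quotient of `Hom(U, X)`, where `U ⊆ P(j)` is the trace of the `P(k)`, `k > j`;
this vanishes once no such `P(k)` maps to `X` (`extOneVanishes_standardModule`).

For (b), downward induction turns (C1) into `Hom(P(j), I ⊗ Δ(i)) = 0` for `j > i`
(`homVanishes_of_standardModule`), and `I ⊗ Δ(i)` surjects onto `I ⊗ S(i)`. -/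

open CategoryTheory

/-! ### Indecomposable and hollow modules. -/

section Modules

variable {A : Type u} [Ring A]

/-- A module is hollow if it is not the sum of two proper submodules. -/
def IsHollowModule (A : Type u) [Ring A] (M : Type u) [AddCommGroup M] [Module A M] : Prop :=
  ∀ N N' : Submodule A M, N ⊔ N' = ⊤ → N = ⊤ ∨ N' = ⊤

theorem isIndecomposableModule_iff (M : Type u) [AddCommGroup M] [Module A M] :
    IsIndecomposableModule A M ↔
      Nontrivial M ∧ ∀ N N' : Submodule A M, IsCompl N N' → N = ⊥ ∨ N' = ⊥ := by
  constructor
  · rintro ⟨h0, h⟩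
    refine ⟨?_, fun N N' hN => ?_⟩
    · by_contra hM
      rw [not_nontrivial_iff_subsingleton] at hM
      exact h0 (ModuleCat.isZero_of_subsingleton _)
    · have e : ModuleCat.of A M ≅ ModuleCat.of A N ⊞ ModuleCat.of A N' :=
        (Submodule.prodEquivOfIsCompl N N' hN).symm.toModuleIso ≪≫
          (ModuleCat.biprodIsoProd (ModuleCat.of A N) (ModuleCat.of A N')).symm
      refine (h _ _ e).imp (fun hz => ?_) (fun hz => ?_)
      · have : Subsingleton N := ModuleCat.subsingleton_of_isZero hz
        exact Submodule.subsingleton_iff_eq_bot.mp this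
      · have : Subsingleton N' := ModuleCat.subsingleton_of_isZero hz
        exact Submodule.subsingleton_iff_eq_bot.mp this
  · rintro ⟨h0, h⟩
    refine ⟨fun hz => ?_, fun Y Z e => ?_⟩
    · have : Subsingleton M := ModuleCat.subsingleton_of_isZero hz
      exact not_subsingleton M this
    · let e' : M ≃ₗ[A] Y × Z := (e ≪≫ ModuleCat.biprodIsoProd Y Z).toLinearEquiv
      have hc : IsCompl (LinearMap.ker (LinearMap.fst A Y Z ∘ₗ e'.toLinearMap))
          (LinearMap.ker (LinearMap.snd A Y Z ∘ₗ e'.toLinearMap)) := by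
        constructor
        · rw [Submodule.disjoint_def]
          intro x hx hx'
          apply e'.injective
          rw [map_zero]
          exact Prod.ext hx hx'
        · rw [codisjoint_iff, eq_top_iff]
          intro x _
          rw [Submodule.mem_sup]
          refine ⟨e'.symm (0, (e' x).2), ?_, e'.symm ((e' x).1, 0), ?_, ?_⟩
          · simp
          · simp
          · rw [← map_add]
            simp
      rcases h _ _ hc with h | h
      · right
        have : Subsingleton Z := by
          refine subsingleton_of_forall_eq 0 fun z => ?_
          have hz : e'.symm (0, z) ∈ LinearMap.ker (LinearMap.fst A Y Z ∘ₗ e'.toLinearMap) := by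
            simp
          rw [h, Submodule.mem_bot, LinearEquiv.map_eq_zero_iff] at hz
          exact congrArg Prod.snd hz
        exact ModuleCat.isZero_of_subsingleton _
      · left
        have : Subsingleton Y := by
          refine subsingleton_of_forall_eq 0 fun z => ?_
          have hz : e'.symm (z, 0) ∈ LinearMap.ker (LinearMap.snd A Y Z ∘ₗ e'.toLinearMap) := by
            simp
          rw [h, Submodule.mem_bot, LinearEquiv.map_eq_zero_iff] at hz
          exact congrArg Prod.fst hz
        exact ModuleCat.isZero_of_subsingleton _

section Hollow

variable {M : Type u} [AddCommGroup M] [Module A M]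

theorem IsHollowModule.of_surjective {N : Type u} [AddCommGroup N] [Module A N]
    (h : IsHollowModule A M) (f : M →ₗ[A] N) (hf : Function.Surjective f) :
    IsHollowModule A N := by
  intro K K' hK
  have key : ∀ L : Submodule A N, L.comap f = ⊤ → L = ⊤ := by
    intro L hL
    rw [← Submodule.map_comap_eq_of_surjective hf L, hL, Submodule.map_top,
      LinearMap.range_eq_top.mpr hf]
  refine (h (K.comap f) (K'.comap f) ?_).imp (key K) (key K')
  rw [eq_top_iff]
  intro x _
  obtain ⟨y, hy, z, hz, hyz⟩ := Submodule.mem_sup.mp (hK ▸ Submodule.mem_top : f x ∈ K ⊔ K')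
  obtain ⟨y', rfl⟩ := hf y
  refine Submodule.mem_sup.mpr ⟨y', hy, x - y', ?_, by abel⟩
  rw [Submodule.mem_comap, map_sub, ← hyz, add_sub_cancel_left]
  exact hz

theorem IsHollowModule.isIndecomposableModule [Nontrivial M] (h : IsHollowModule A M) :
    IsIndecomposableModule A M := by
  refine (isIndecomposableModule_iff M).mpr ⟨inferInstance, fun N N' hN => ?_⟩
  rcases h N N' hN.sup_eq_top with rfl | rfl
  · exact Or.inr (by simpa using hN.inf_eq_bot)
  · exact Or.inl (by simpa using hN.inf_eq_bot)

/-- A maximal submodule `C` not containing `N` would give `N + C = M` with both summands proper. -/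
theorem IsHollowModule.le_jacobson (h : IsHollowModule A M) {N : Submodule A M} (hN : N ≠ ⊤) :
    N ≤ Module.jacobson A M := by
  refine le_sInf fun C hC => ?_
  by_contra hNC
  exact (h N C (hC.2 _ (right_lt_sup.mpr hNC))).elim hN hC.1

theorem IsHollowModule.isCoatom_jacobson [Module.Finite A M] [Nontrivial M]
    (h : IsHollowModule A M) : IsCoatom (Module.jacobson A M) := by
  obtain ⟨C, hC, -⟩ := (eq_top_or_exists_le_coatom (⊥ : Submodule A M)).resolve_left bot_ne_top
  have : Module.jacobson A M = C := le_antisymm (sInf_le hC) (h.le_jacobson hC.1)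
  rwa [this]

/-- Fitting's lemma. -/
theorem IsIndecomposableModule.isNilpotent_or_bijective [IsArtinian A M] [IsNoetherian A M]
    (h : IsIndecomposableModule A M) (f : Module.End A M) :
    IsNilpotent f ∨ Function.Bijective f := by
  -- Positivity of `n` allows a factor `f` to be split off `f ^ n` on either side.
  obtain ⟨n, hn, hn0⟩ := (f.eventually_isCompl_ker_pow_range_pow.and
    (Filter.eventually_gt_atTop 0)).exists
  rcases ((isIndecomposableModule_iff M).mp h).2 _ _ hn with h0 | h0
  · right
    rw [h0] at hn
    have hr : LinearMap.range (f ^ n) = ⊤ := by simpa using hn.sup_eq_top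
    obtain ⟨m, rfl⟩ := Nat.exists_eq_succ_of_ne_zero hn0.ne'
    constructor
    · have hi := LinearMap.ker_eq_bot.mp h0
      rw [pow_succ, Module.End.coe_mul] at hi
      exact hi.of_comp
    · have hs := LinearMap.range_eq_top.mp hr
      rw [pow_succ', Module.End.coe_mul] at hs
      exact hs.of_comp
  · left
    exact ⟨n, LinearMap.range_eq_bot.mp h0⟩

/-- If `N + N' = M`, a section of `N × N' → M` writes `1 = f + g` with `f` valued in `N` and `g` in
`N'`. By Fitting, `f` is bijective or `g = 1 - f` is a unit, so one of the two submodules is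
everything. -/
theorem IsIndecomposableModule.isHollowModule [IsArtinian A M] [IsNoetherian A M]
    [Module.Projective A M] (h : IsIndecomposableModule A M) : IsHollowModule A M := by
  intro N N' hN
  let q : N × N' →ₗ[A] M := N.subtype.coprod N'.subtype
  have hq : Function.Surjective q := by
    rw [← LinearMap.range_eq_top, LinearMap.range_coprod, Submodule.range_subtype,
      Submodule.range_subtype, hN]
  obtain ⟨s, hs⟩ := Module.projective_lifting_property q LinearMap.id hq
  let f : Module.End A M := N.subtype ∘ₗ LinearMap.fst A N N' ∘ₗ s
  let g : Module.End A M := N'.subtype ∘ₗ LinearMap.snd A N N' ∘ₗ s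
  have hfg : f + g = 1 := by
    ext x
    exact LinearMap.congr_fun hs x
  rcases h.isNilpotent_or_bijective f with hf | hf
  · right
    have hg : IsUnit g := by
      rw [eq_sub_of_add_eq' hfg]
      exact hf.isUnit_one_sub
    rw [eq_top_iff]
    intro x _
    obtain ⟨y, rfl⟩ := ((Module.End.isUnit_iff _).mp hg).2 x
    exact (s y).2.2
  · left
    rw [eq_top_iff]
    intro x _
    obtain ⟨y, rfl⟩ := hf.2 x
    exact (s y).1.2

end Hollow

/-! ### Vanishing of Hom and Ext¹. -/

section HomVanishes

variable {M N X Y : Type u} [AddCommGroup M] [Module A M] [AddCommGroup N] [Module A N]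
  [AddCommGroup X] [Module A X] [AddCommGroup Y] [Module A Y]

theorem HomVanishes.of_injective (h : HomVanishes A M Y) (g : X →ₗ[A] Y)
    (hg : Function.Injective g) : HomVanishes A M X := by
  intro f
  ext x
  apply hg
  rw [LinearMap.zero_apply, map_zero]
  exact LinearMap.congr_fun (h (g ∘ₗ f)) x

theorem HomVanishes.of_surjective [Module.Projective A M] (h : HomVanishes A M X)
    (g : X →ₗ[A] Y) (hg : Function.Surjective g) : HomVanishes A M Y := by
  intro f
  obtain ⟨f', rfl⟩ := Module.projective_lifting_property g f hg
  rw [h f', LinearMap.comp_zero]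

theorem HomVanishes.of_surjective_source (h : HomVanishes A M X) (g : M →ₗ[A] N)
    (hg : Function.Surjective g) : HomVanishes A N X := by
  intro f
  ext y
  obtain ⟨x, rfl⟩ := hg y
  exact LinearMap.congr_fun (h (f ∘ₗ g)) x

theorem HomVanishes.of_quotient {K : Submodule A X} (h : HomVanishes A M K)
    (h' : HomVanishes A M (X ⧸ K)) : HomVanishes A M X := by
  intro f
  have hf : ∀ x, f x ∈ K := fun x => by
    rw [← Submodule.Quotient.mk_eq_zero]
    exact LinearMap.congr_fun (h' (K.mkQ ∘ₗ f)) x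
  ext x
  exact congrArg Subtype.val (LinearMap.congr_fun (h (f.codRestrict K hf)) x)

theorem HomVanishes.traceSubmodule_le_ker (h : HomVanishes A M X) (f : N →ₗ[A] X) :
    traceSubmodule A M N ≤ LinearMap.ker f := by
  refine iSup_le fun g => ?_
  rw [LinearMap.range_le_ker_iff]
  exact h _

theorem HomVanishes.traceSubmodule (h : HomVanishes A M X) :
    HomVanishes A (traceSubmodule A M N) X := by
  intro g
  -- The kernel is pushed forward to `N`, where the trace is a supremum of images, so it is enough
  -- to treat one generating morphism at a time.
  have key : _root_.traceSubmodule A M N ≤ (LinearMap.ker g).map (Submodule.subtype _) := by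
    refine iSup_le fun f => ?_
    rintro _ ⟨x, rfl⟩
    have hf : ∀ x, f x ∈ _root_.traceSubmodule A M N := fun x =>
      le_iSup (fun f : M →ₗ[A] N => LinearMap.range f) f ⟨x, rfl⟩
    exact ⟨⟨f x, hf x⟩, LinearMap.congr_fun (h (g ∘ₗ f.codRestrict _ hf)) x, rfl⟩
  ext x
  obtain ⟨y, hy, hxy⟩ := key x.2
  rw [← Subtype.ext hxy]
  exact hy

/-- In the long exact sequence of `0 → U → M → M ⧸ U → 0`, `Ext¹(M, X) = 0` makes the connecting map
`Hom(U, X) → Ext¹(M ⧸ U, X)` onto. -/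
theorem HomVanishes.extOneVanishes_quotient [Module.Projective A M] {U : Submodule A M}
    (h : HomVanishes A U X) : ExtOneVanishes A (M ⧸ U) X := by
  let S : ShortComplex (ModuleCat.{u} A) :=
    ShortComplex.mk (ModuleCat.ofHom U.subtype) (ModuleCat.ofHom U.mkQ) (by
      ext x
      simp)
  have hS : S.ShortExact :=
    { exact := by
        rw [ShortComplex.moduleCat_exact_iff_range_eq_ker]
        simp [S]
      mono_f := (ModuleCat.mono_iff_injective _).mpr U.injective_subtype
      epi_g := (ModuleCat.epi_iff_surjective _).mpr U.mkQ_surjective }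
  have : Projective S.X₂ := ModuleCat.projective_of_categoryTheory_projective (ModuleCat.of A M)
  refine subsingleton_of_forall_eq 0 fun x => ?_
  obtain ⟨x₁, rfl⟩ := Abelian.Ext.contravariant_sequence_exact₃ hS (ModuleCat.of A X) x
    (Abelian.Ext.eq_zero_of_projective _) (n₀ := 0) rfl
  have hx : x₁ = 0 := by
    apply Abelian.Ext.addEquiv₀.injective
    rw [map_zero]
    exact ModuleCat.hom_ext (h _)
  rw [hx, Abelian.Ext.comp_zero]

end HomVanishes

/-! ### Tensor products with a bimodule and their right exactness. -/

namespace BimoduleTensor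

variable {X : Type u} [AddCommGroup X] [Module A X] [Module Aᵐᵒᵖ X] [SMulCommClass A Aᵐᵒᵖ X]
  {M N T : Type u} [AddCommGroup M] [Module A M] [AddCommGroup N] [Module A N]
  [AddCommGroup T] [Module A T]

variable (A X M) in
/-- The canonical balanced map `(x, m) ↦ x ⊗ m`. -/
def mk : X →ₗ[A] M →ₗ[ℤ] BimoduleTensor A X M :=
  LinearMap.mk₂' A ℤ (fun x m => Submodule.Quotient.mk (x ⊗ₜ[ℤ] m))
    (fun x y m => by rw [TensorProduct.add_tmul]; rfl)
    (fun a x m => by rw [← TensorProduct.smul_tmul']; rfl)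
    (fun x m n => by rw [TensorProduct.tmul_add]; rfl)
    (fun a x m => by rw [TensorProduct.tmul_smul]; rfl)

theorem mk_smul (x : X) (a : A) (m : M) :
    mk A X M x (a • m) = mk A X M (MulOpposite.op a • x) m :=
  ((Submodule.Quotient.eq (Submodule.span A {z : TensorProduct ℤ X M | ∃ (x : X) (a : A) (m : M),
      z = TensorProduct.tmul ℤ (MulOpposite.op a • x) m - TensorProduct.tmul ℤ x (a • m)})).mpr
    (Submodule.subset_span ⟨x, a, m, rfl⟩)).symm

theorem eq_top_of_mk_mem (K : Submodule A (BimoduleTensor A X M))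
    (h : ∀ x m, mk A X M x m ∈ K) : K = ⊤ := by
  rw [eq_top_iff]
  intro z _
  obtain ⟨z, rfl⟩ := Submodule.Quotient.mk_surjective _ z
  induction z using TensorProduct.induction_on with
  | zero => exact K.zero_mem
  | tmul x m => exact h x m
  | add y z hy hz => exact K.add_mem (hy trivial) (hz trivial)

/-- The linear map induced by a balanced map. -/
def lift (f : X →ₗ[A] M →ₗ[ℤ] T)
    (hf : ∀ x (a : A) m, f (MulOpposite.op a • x) m = f x (a • m)) :
    BimoduleTensor A X M →ₗ[A] T :=
  Submodule.liftQ _ (TensorProduct.AlgebraTensorModule.lift f) (by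
    rw [Submodule.span_le]
    rintro _ ⟨x, a, m, rfl⟩
    rw [SetLike.mem_coe, LinearMap.mem_ker, map_sub, TensorProduct.AlgebraTensorModule.lift_tmul,
      TensorProduct.AlgebraTensorModule.lift_tmul, hf, sub_self])

theorem lift_mk (f : X →ₗ[A] M →ₗ[ℤ] T)
    (hf : ∀ x (a : A) m, f (MulOpposite.op a • x) m = f x (a • m)) (x : X) (m : M) :
    lift f hf (mk A X M x m) = f x m :=
  TensorProduct.AlgebraTensorModule.lift_tmul f x m

variable (X) in
/-- The linear map `X ⊗ f`. -/
def map (f : M →ₗ[A] N) : BimoduleTensor A X M →ₗ[A] BimoduleTensor A X N :=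
  lift (LinearMap.mk₂' A ℤ (fun x m => mk A X N x (f m))
    (fun x y m => by rw [map_add]; rfl) (fun a x m => by rw [map_smul]; rfl)
    (fun x m n => by rw [map_add, map_add]) (fun a x m => by rw [map_zsmul, map_zsmul]))
    (fun x a m => by
      rw [LinearMap.mk₂'_apply, LinearMap.mk₂'_apply, f.map_smul, mk_smul])

theorem map_mk (f : M →ₗ[A] N) (x : X) (m : M) : map X f (mk A X M x m) = mk A X N x (f m) :=
  lift_mk _ _ _ _

theorem map_surjective (f : M →ₗ[A] N) (hf : Function.Surjective f) :
    Function.Surjective (map X f) := by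
  rw [← LinearMap.range_eq_top]
  refine eq_top_of_mk_mem _ fun x n => ?_
  obtain ⟨m, rfl⟩ := hf n
  exact ⟨_, map_mk f x m⟩

/-- The tensor product with `M ⧸ K` surjects onto the cokernel of `X ⊗ K → X ⊗ M`. -/
theorem exists_surjective_quotient (K : Submodule A M) :
    ∃ g : BimoduleTensor A X (M ⧸ K) →ₗ[A]
      (BimoduleTensor A X M ⧸ LinearMap.range (map X K.subtype)), Function.Surjective g := by
  let R := LinearMap.range (map X K.subtype)
  -- For fixed `x`, the class of `x ⊗ m` depends only on `m` modulo `K`, because `x ⊗ k` lies in `R`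
  -- for `k ∈ K`.
  let φ : X → (M ⧸ K) →ₗ[ℤ] (BimoduleTensor A X M ⧸ R) := fun x =>
    (QuotientAddGroup.lift K.toAddSubgroup
      ((R.mkQ.toAddMonoidHom).comp (mk A X M x).toAddMonoidHom) (fun k hk => by
        refine (Submodule.Quotient.mk_eq_zero R).mpr ?_
        exact ⟨mk A X K x ⟨k, hk⟩, map_mk _ _ _⟩)).toIntLinearMap
  have hφ : ∀ x m, φ x (Submodule.Quotient.mk m) = R.mkQ (mk A X M x m) := fun _ _ => rfl
  let f : X →ₗ[A] (M ⧸ K) →ₗ[ℤ] (BimoduleTensor A X M ⧸ R) :=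
    { toFun := φ
      map_add' := fun x y => by
        refine LinearMap.ext fun m => ?_
        obtain ⟨m, rfl⟩ := Submodule.Quotient.mk_surjective _ m
        rw [LinearMap.add_apply, hφ, hφ, hφ, map_add, LinearMap.add_apply, map_add]
      map_smul' := fun a x => by
        refine LinearMap.ext fun m => ?_
        obtain ⟨m, rfl⟩ := Submodule.Quotient.mk_surjective _ m
        rw [RingHom.id_apply, LinearMap.smul_apply, hφ, hφ, map_smul, LinearMap.smul_apply,
          map_smul] }
  have hf : ∀ x (a : A) m, f (MulOpposite.op a • x) m = f x (a • m) := by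
    intro x a m
    obtain ⟨m, rfl⟩ := Submodule.Quotient.mk_surjective _ m
    change φ _ _ = φ _ (Submodule.Quotient.mk (a • m))
    rw [hφ, hφ, mk_smul]
  refine ⟨lift f hf, ?_⟩
  intro z
  obtain ⟨z, rfl⟩ := Submodule.Quotient.mk_surjective _ z
  have key : (LinearMap.range (lift f hf)).comap R.mkQ = ⊤ := by
    refine eq_top_of_mk_mem _ fun x m => ?_
    exact ⟨mk A X (M ⧸ K) x (Submodule.Quotient.mk m), lift_mk f hf _ _⟩
  exact (key ▸ Submodule.mem_top : z ∈ (LinearMap.range (lift f hf)).comap R.mkQ)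

/-- The image of `X ⊗ K` in `X ⊗ M` and its cokernel are quotients of `X ⊗ K` and `X ⊗ (M ⧸ K)`;
projectivity of `Q` carries the vanishing to both. -/
theorem homVanishes_of_quotient {Q : Type u} [AddCommGroup Q] [Module A Q] [Module.Projective A Q]
    (K : Submodule A M) (h : HomVanishes A Q (BimoduleTensor A X K))
    (h' : HomVanishes A Q (BimoduleTensor A X (M ⧸ K))) :
    HomVanishes A Q (BimoduleTensor A X M) := by
  obtain ⟨g, hg⟩ := exists_surjective_quotient (X := X) K
  exact HomVanishes.of_quotient
    (h.of_surjective (map X K.subtype).rangeRestrict (LinearMap.surjective_rangeRestrict _))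
    (h'.of_surjective g hg)

theorem finite [Module.Finite A X] [Module.Finite A M] :
    Module.Finite A (BimoduleTensor A X M) := by
  obtain ⟨n, s, hs⟩ := Module.Finite.exists_fin (R := A) (M := M)
  let g : (Fin n → X) →ₗ[A] BimoduleTensor A X M :=
    ∑ i, ((mk A X M).flip (s i)) ∘ₗ LinearMap.proj i
  have hg : ∀ x i, mk A X M x (s i) ∈ LinearMap.range g := by
    intro x i
    refine ⟨Pi.single i x, ?_⟩
    rw [LinearMap.sum_apply, Finset.sum_eq_single i]
    · simp
    · intro j _ hj
      simp [hj]
    · simp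
  refine Module.Finite.of_surjective g (LinearMap.range_eq_top.mp ?_)
  refine eq_top_of_mk_mem _ fun x m => ?_
  have hm : m ∈ Submodule.span A (Set.range s) := hs ▸ Submodule.mem_top
  -- `x` must vary, since a scalar on `m` is moved onto `x`.
  induction hm using Submodule.span_induction generalizing x with
  | mem m hm =>
    obtain ⟨i, rfl⟩ := hm
    exact hg x i
  | zero => simp
  | add m m' _ _ h h' =>
    rw [map_add]
    exact Submodule.add_mem _ (h x) (h' x)
  | smul a m _ h =>
    rw [mk_smul]
    exact h _

end BimoduleTensor

/-! ### Indecomposable projectives, their simple tops and composition factors. -/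

section Representatives

variable {ι : Type} {P : ι → Type u} [∀ i, AddCommGroup (P i)]
  [∀ i, Module A (P i)]

theorem IsRepresentativeProjectives.isHollowModule [IsArtinianRing A]
    (hP : IsRepresentativeProjectives A P) (i : ι) : IsHollowModule A (P i) := by
  have := hP.finite i
  have := hP.projective i
  exact (hP.indecomposable i).isHollowModule

theorem IsRepresentativeProjectives.nontrivial
    (hP : IsRepresentativeProjectives A P) (i : ι) : Nontrivial (P i) :=
  ((isIndecomposableModule_iff _).mp (hP.indecomposable i)).1

theorem IsRepresentativeProjectives.isSimpleModule [IsArtinianRing A]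
    (hP : IsRepresentativeProjectives A P) (i : ι) :
    IsSimpleModule A (SimpleTop A P i) := by
  have := hP.finite i
  have := hP.nontrivial i
  exact isSimpleModule_iff_isCoatom.mpr (hP.isHollowModule i).isCoatom_jacobson

theorem IsRepresentativeProjectives.eq_of_surjective
    (hP : IsRepresentativeProjectives A P) {i j : ι} (f : P i →ₗ[A] P j)
    (hf : Function.Surjective f) : i = j := by
  have := hP.projective j
  have := hP.nontrivial j
  obtain ⟨s, hs⟩ := Module.projective_lifting_property f LinearMap.id hf
  have hs' : Function.LeftInverse f s := fun x => LinearMap.congr_fun hs x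
  -- Up to `P j ≃ range s`, `f` is the projection onto `range s`, so its kernel is a complement of
  -- that range in the indecomposable `P i`.
  have hc := LinearMap.isCompl_of_proj (f := ((LinearEquiv.ofInjective s hs'.injective).toLinearMap
    ∘ₗ f)) (p := LinearMap.range s) (by
      rintro ⟨_, x, rfl⟩
      apply Subtype.ext
      simp [hs' x])
  rw [LinearMap.ker_comp, LinearEquiv.ker, Submodule.comap_bot] at hc
  rcases ((isIndecomposableModule_iff _).mp (hP.indecomposable i)).2 _ _ hc with h | h
  · rw [LinearMap.range_eq_bot] at h
    obtain ⟨x, hx⟩ := exists_ne (0 : P j)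
    refine absurd ?_ hx
    rw [← hs' x, h, LinearMap.zero_apply, map_zero]
  · exact hP.eq_of_equiv i j ⟨LinearEquiv.ofBijective f ⟨LinearMap.ker_eq_bot.mp h, hf⟩⟩

/-- A simple module receiving a nonzero morphism from `P i` is the top of `P i`. -/
theorem IsRepresentativeProjectives.nonempty_equiv_simpleTop [IsArtinianRing A]
    (hP : IsRepresentativeProjectives A P) {L : Type u} [AddCommGroup L]
    [Module A L] [IsSimpleModule A L] {i : ι} {f : P i →ₗ[A] L} (hf : f ≠ 0) :
    Nonempty (L ≃ₗ[A] SimpleTop A P i) := by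
  have := hP.finite i
  have := hP.nontrivial i
  have hs := LinearMap.surjective_of_ne_zero hf
  have hk : IsCoatom (LinearMap.ker f) := LinearMap.isCoatom_ker_of_surjective hs
  have hj : LinearMap.ker f = Module.jacobson A (P i) :=
    le_antisymm ((hP.isHollowModule i).le_jacobson hk.1) (sInf_le hk)
  exact ⟨((Submodule.quotEquivOfEq _ _ hj.symm).trans (f.quotKerEquivOfSurjective hs)).symm⟩

/-- Induction on length: a decomposable `Q` splits into two shorter projectives, and `f` is nonzero
on at least one of them. -/
theorem IsRepresentativeProjectives.exists_ne_zero [IsArtinianRing A]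
    (hP : IsRepresentativeProjectives A P) {L : Type u} [AddCommGroup L] [Module A L]
    (Q : Type u) [AddCommGroup Q] [Module A Q] [Module.Finite A Q] [Module.Projective A Q]
    (f : Q →ₗ[A] L) (hf : f ≠ 0) : ∃ (k : ι) (g : P k →ₗ[A] L), g ≠ 0 := by
  induction hn : Module.length A Q using WellFoundedLT.induction generalizing Q with
  | ind n ih =>
    by_cases hQ : IsIndecomposableModule A Q
    · obtain ⟨k, ⟨e⟩⟩ := hP.exists_equiv Q inferInstance inferInstance hQ
      refine ⟨k, f ∘ₗ e.symm.toLinearMap, fun h => hf ?_⟩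
      ext x
      simpa using LinearMap.congr_fun h (e x)
    · rw [isIndecomposableModule_iff] at hQ
      push Not at hQ
      have hnt : Nontrivial Q := by
        obtain ⟨x, hx⟩ := DFunLike.ne_iff.mp hf
        exact ⟨x, 0, fun h => hx (by simp [h])⟩
      obtain ⟨N, N', hN, h, h'⟩ := hQ hnt
      have step : ∀ K K' : Submodule A Q, IsCompl K K' → K' ≠ ⊥ → f ∘ₗ K.subtype ≠ 0 →
          ∃ (k : ι) (g : P k →ₗ[A] L), g ≠ 0 := by
        intro K K' hK h0 hfK
        have hK' : K ≠ ⊤ := fun h => h0 (by simpa [h] using hK.inf_eq_bot)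
        have : Module.Projective A K := Module.Projective.of_split K.subtype
          (K.projectionOnto K' hK) (by ext x; simp)
        exact ih _ (hn ▸ Submodule.length_lt hK') K (f ∘ₗ K.subtype) hfK rfl
      by_cases h1 : f ∘ₗ N.subtype = 0
      · refine step N' N hN.symm h fun h2 => hf ?_
        have : (⊤ : Submodule A Q) ≤ LinearMap.ker f := by
          rw [← hN.sup_eq_top]
          refine sup_le (fun x hx => ?_) (fun x hx => ?_)
          · exact LinearMap.congr_fun h1 ⟨x, hx⟩
          · exact LinearMap.congr_fun h2 ⟨x, hx⟩
        exact LinearMap.ker_eq_top.mp (top_le_iff.mp this)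
      · exact step N N' hN h' h1

theorem IsRepresentativeProjectives.exists_equiv_simpleTop [IsArtinianRing A]
    (hP : IsRepresentativeProjectives A P) (L : Type u) [AddCommGroup L]
    [Module A L] [IsSimpleModule A L] :
    ∃ k, Nonempty (L ≃ₗ[A] SimpleTop A P k) := by
  have := IsSimpleModule.nontrivial A L
  obtain ⟨x, hx⟩ := exists_ne (0 : L)
  obtain ⟨k, g, hg⟩ := hP.exists_ne_zero A (LinearMap.toSpanSingleton A L x) (fun h => hx (by
    simpa using LinearMap.congr_fun h 1))
  exact ⟨k, hP.nonempty_equiv_simpleTop hg⟩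

/-- The simple module `S(i)` is a composition factor of `M` if and only if there is a nonzero
morphism from `P(i)` to `M`. -/
theorem IsRepresentativeProjectives.compositionMultiplicity_eq_zero_iff [IsArtinianRing A]
    (hP : IsRepresentativeProjectives A P) {M : Type u}
    [AddCommGroup M] [Module A M] [Module.Finite A M] (i : ι) :
    compositionMultiplicity A M (SimpleTop A P i) = 0 ↔ HomVanishes A (P i) M := by
  have := hP.projective i
  have := hP.isSimpleModule i
  obtain ⟨s, hs⟩ := exists_compositionSeries_of_isNoetherian_isArtinian A M
  rw [compositionMultiplicity_eq A M _ s hs, Set.encard_eq_zero]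
  constructor
  · intro h
    -- Climbing the series, a first nonzero morphism would induce one to a simple factor, which
    -- would then be `S(i)`.
    have key : ∀ k, HomVanishes A (P i) (s k) := by
      intro k
      induction k using Fin.induction with
      | zero =>
        have h0 : s 0 = ⊥ := hs.1
        rw [h0]
        intro f
        exact Subsingleton.elim _ _
      | succ k ih =>
        have hk := s.step k
        have hsimple : IsSimpleModule A (↥(s k.succ) ⧸ (s k.castSucc).submoduleOf (s k.succ)) :=
          (covBy_iff_quot_is_simple hk.le).mp hk
        refine HomVanishes.of_quotient (K := (s k.castSucc).submoduleOf (s k.succ)) ?_ ?_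
        · exact ih.of_injective (Submodule.submoduleOfEquivOfLe hk.le).toLinearMap
            (LinearEquiv.injective _)
        · intro f
          by_contra hf
          exact Set.notMem_empty k (h ▸ hP.nonempty_equiv_simpleTop hf)
    have h1 := key (Fin.last _)
    have h2 : s (Fin.last _) = ⊤ := hs.2
    rw [h2] at h1
    exact h1.of_injective Submodule.topEquiv.symm.toLinearMap (LinearEquiv.injective _)
  · intro h
    rw [Set.eq_empty_iff_forall_notMem]
    rintro k ⟨e⟩
    -- `S(i)` is now a subquotient of `M`, so even the canonical `P(i) → S(i)` would vanish.
    have h1 : HomVanishes A (P i) (SimpleTop A P i) :=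
      (h.of_injective _ (s k.succ).injective_subtype).of_surjective
        (e.toLinearMap ∘ₗ Submodule.mkQ _) (e.surjective.comp (Submodule.mkQ_surjective _))
    have := IsSimpleModule.nontrivial A (SimpleTop A P i)
    obtain ⟨x, hx⟩ := exists_ne (0 : SimpleTop A P i)
    obtain ⟨y, rfl⟩ := Submodule.mkQ_surjective _ x
    exact hx (LinearMap.congr_fun (h1 (Submodule.mkQ _)) y)

/-! ### Standard modules. -/

variable [LinearOrder ι]

theorem homVanishes_directSum {X : Type u} [AddCommGroup X] [Module A X] {i : ι}
    (h : ∀ k, i < k → HomVanishes A (P k) X) :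
    HomVanishes A (DirectSum (Set.Ioi i) fun j => P j) X := by
  intro f
  refine DirectSum.linearMap_ext A fun k => ?_
  rw [LinearMap.zero_comp]
  exact h k k.2 _

theorem homVanishes_standardModule_of_lt {i k : ι} [Module.Projective A (P k)] (h : i < k) :
    HomVanishes A (P k) (StandardModule A P i) := by
  intro f
  obtain ⟨g, rfl⟩ := Module.projective_lifting_property (Submodule.mkQ _) f
    (Submodule.mkQ_surjective _)
  ext x
  refine (Submodule.Quotient.mk_eq_zero _).mpr ?_
  -- The lift `g` extends to the direct sum by projecting to the `k`-th summand, so its image lies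
  -- in the trace.
  refine Submodule.mem_iSup_of_mem
    (g ∘ₗ DirectSum.component A (Set.Ioi i) (fun j => P j) ⟨k, h⟩)
    ⟨DirectSum.lof A (Set.Ioi i) (fun j => P j) ⟨k, h⟩ x, ?_⟩
  rw [LinearMap.comp_apply, DirectSum.component.lof_self]

theorem IsRepresentativeProjectives.extOneVanishes_standardModule
    (hP : IsRepresentativeProjectives A P) {X : Type u} [AddCommGroup X]
    [Module A X] {i : ι} (h : ∀ k, i < k → HomVanishes A (P k) X) :
    ExtOneVanishes A (StandardModule A P i) X := by
  have := hP.projective i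
  exact HomVanishes.extOneVanishes_quotient (homVanishes_directSum h).traceSubmodule

/-- No `P(k) → P(i)` with `k > i` is onto, as that would force `k = i`; hence each image lies in the
radical of the hollow module `P(i)`. -/
theorem IsRepresentativeProjectives.traceSubmodule_ne_top [IsArtinianRing A]
    (hP : IsRepresentativeProjectives A P) (i : ι) :
    traceSubmodule A (DirectSum (Set.Ioi i) fun j => P j) (P i) ≠ ⊤ := by
  have := hP.finite i
  have := hP.nontrivial i
  have hJ := hP.isHollowModule i
  refine ne_top_of_le_ne_top hJ.isCoatom_jacobson.1 (iSup_le fun f => ?_)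
  have hk : ∀ k : Set.Ioi i, LinearMap.range (f ∘ₗ DirectSum.lof A (Set.Ioi i) (fun j => P j) k) ≤
      Module.jacobson A (P i) := fun k => hJ.le_jacobson fun h =>
    (ne_of_gt k.2) (hP.eq_of_surjective _ (LinearMap.range_eq_top.mp h))
  rintro _ ⟨x, rfl⟩
  induction x using DirectSum.induction_on with
  | zero => simp
  | of k x => exact hk k ⟨x, rfl⟩
  | add x y hx hy =>
    rw [map_add]
    exact Submodule.add_mem _ hx hy

theorem IsRepresentativeProjectives.isStratifyingSystem_standardModule [IsArtinianRing A]
    (hP : IsRepresentativeProjectives A P) :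
    IsStratifyingSystem A (StandardModule A P) where
  finite i := by
    have := hP.finite i
    infer_instance
  indecomposable i := by
    have : Nontrivial (StandardModule A P i) :=
      Submodule.Quotient.nontrivial_iff.mpr (hP.traceSubmodule_ne_top i)
    exact ((hP.isHollowModule i).of_surjective _ (Submodule.mkQ_surjective _)).isIndecomposableModule
  hom_eq_zero i j h := by
    have := hP.projective i
    exact (homVanishes_standardModule_of_lt h).of_surjective_source _ (Submodule.mkQ_surjective _)
  ext_eq_zero i j h := by
    refine hP.extOneVanishes_standardModule fun k hk => ?_
    have := hP.projective k
    exact homVanishes_standardModule_of_lt (h.trans_lt hk)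

/-- If every standard module `Δ(k)` with `k > i` has no nonzero morphism to `X`, then neither has
any `P(k)` with `k > i`. -/
theorem homVanishes_of_standardModule [Finite ι] {X : Type u} [AddCommGroup X] [Module A X] {i : ι}
    (h : ∀ k, i < k → HomVanishes A (StandardModule A P k) X) :
    ∀ k, i < k → HomVanishes A (P k) X := by
  intro k
  induction k using WellFoundedGT.induction with
  | ind k ih =>
    intro hk f
    -- By downward induction `f` kills the trace of the larger projectives, so it factors through
    -- `Δ(k)`.
    have hle := (homVanishes_directSum fun l hl => ih l hl (hk.trans hl)).traceSubmodule_le_ker f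
    rw [← Submodule.liftQ_mkQ _ f hle, h k hk (Submodule.liftQ _ f hle), LinearMap.zero_comp]

/-- Vanishing of `Hom(P(j), X ⊗ -)` on the modules with composition factors among the `S(k)`,
`k ≤ i`, follows from the vanishing on these simple modules. -/
theorem IsRepresentativeProjectives.homVanishes_bimoduleTensor [IsArtinianRing A]
    (hP : IsRepresentativeProjectives A P) {X : Type u} [AddCommGroup X]
    [Module A X] [Module Aᵐᵒᵖ X] [SMulCommClass A Aᵐᵒᵖ X] {i j : ι}
    (hX : ∀ k, k ≤ i → HomVanishes A (P j) (BimoduleTensor A X (SimpleTop A P k)))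
    {M : Type u} [AddCommGroup M] [Module A M] (hM : IsFiniteLength A M)
    (h : ∀ k, i < k → HomVanishes A (P k) M) :
    HomVanishes A (P j) (BimoduleTensor A X M) := by
  have := hP.projective j
  induction hM with
  | @of_subsingleton M _ _ _ =>
    have : (⊥ : Submodule A (BimoduleTensor A X M)) = ⊤ :=
      BimoduleTensor.eq_top_of_mk_mem _ fun x m => by
        rw [Subsingleton.elim m 0, map_zero]
        exact Submodule.zero_mem _
    have := Submodule.subsingleton_iff A |>.mp (subsingleton_of_bot_eq_top this)
    intro f
    exact Subsingleton.elim _ _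
  | @of_simple_quotient M _ _ N _ _ ih =>
    refine BimoduleTensor.homVanishes_of_quotient N
      (ih fun k hk => (h k hk).of_injective _ N.injective_subtype) ?_
    obtain ⟨k, ⟨e⟩⟩ := hP.exists_equiv_simpleTop (M ⧸ N)
    refine (hX k ?_).of_surjective (BimoduleTensor.map X e.symm.toLinearMap)
      (BimoduleTensor.map_surjective _ e.symm.surjective)
    -- If `i < k`, then `Hom(P(k), M) = 0` passes to the quotient `M ⧸ N ≃ S(k)`, contradicting
    -- `P(k) → S(k)` being nonzero.
    by_contra! hk
    have := hP.projective k
    have := hP.isSimpleModule k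
    have := IsSimpleModule.nontrivial A (SimpleTop A P k)
    obtain ⟨x, hx⟩ := exists_ne (0 : SimpleTop A P k)
    obtain ⟨y, rfl⟩ := Submodule.mkQ_surjective _ x
    have hv := (h k hk).of_surjective (e.toLinearMap ∘ₗ N.mkQ)
      (e.surjective.comp (Submodule.mkQ_surjective _))
    exact hx (LinearMap.congr_fun (hv (Submodule.mkQ _)) y)

end Representatives

end Modules

/-! ### The ideal bimodule and the main theorem. -/

/-- Via `σ`, `I` is a left `Λ`-submodule of `Γ`, which is finite over `R`, hence over the noetherian
ring `Λ`. -/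
theorem SplitByNilpotentExtension.finite_idealBimodule {R : Type w} [CommRing R] {Γ Λ : Type u}
    [Ring Γ] [Ring Λ] [Algebra R Γ] [Algebra R Λ] [IsNoetherianRing Λ] [Module.Finite R Γ]
    {I : TwoSidedIdeal Γ} (E : SplitByNilpotentExtension R Γ Λ I) :
    Module.Finite Λ E.IdealBimodule := by
  let _ : Module Λ Γ := Module.compHom Γ E.σ.toRingHom
  have hsmul : ∀ (a : Λ) (x : Γ), a • x = E.σ a * x := fun _ _ => rfl
  have : IsScalarTower R Λ Γ := ⟨fun r a x => by
    rw [hsmul, hsmul, map_smul, smul_mul_assoc]⟩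
  have : Module.Finite Λ Γ := Module.Finite.of_restrictScalars_finite R Λ Γ
  let g : E.IdealBimodule →ₗ[Λ] Γ :=
    { toFun := fun x => (show ↥I from x).1
      map_add' := fun _ _ => rfl
      map_smul' := fun _ _ => rfl }
  exact Module.Finite.of_injective g Subtype.val_injective

theorem mainTheorem10 {R : Type w} [CommRing R] [IsArtinianRing R]
    {Λ Γ : Type u} [Ring Λ] [Ring Γ] [Algebra R Λ] [Algebra R Γ]
    [Module.Finite R Λ] [Module.Finite R Γ]
    {I : TwoSidedIdeal Γ} (E : SplitByNilpotentExtension R Γ Λ I)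
    {ι : Type} [Finite ι] [LinearOrder ι]
    (P : ι → Type u) [∀ i, AddCommGroup (P i)] [∀ i, Module Λ (P i)]
    (hP : IsRepresentativeProjectives Λ P)
    (hI : Module.Projective Λᵐᵒᵖ E.IdealBimodule) :
    IsStratifyingSystem Λ (StandardModule Λ P) ∧
    (E.IsAdmissible (SimpleTop Λ P) → E.IsCompatible (StandardModule Λ P)) ∧
    (IsStandardlyStratified Λ P → E.IsCompatible (StandardModule Λ P) →
      E.IsAdmissible (SimpleTop Λ P)) := by
  have : IsArtinianRing Λ := IsArtinianRing.of_finite R Λ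
  have := E.finite_idealBimodule
  have hfin : ∀ i, Module.Finite Λ (P i) := hP.finite
  have hfinI : ∀ i, Module.Finite Λ (E.IdealTensor (SimpleTop Λ P i)) :=
    fun i => BimoduleTensor.finite
  refine ⟨hP.isStratifyingSystem_standardModule, fun h => ?_, fun _ h i j hij => ?_⟩
  -- Stronger than (C1), with `P j` in place of `Δ(j)`: this is the form that (C2) requires.
  · have key : ∀ i j, i < j → HomVanishes Λ (P j) (E.IdealTensor (StandardModule Λ P i)) := by
      intro i j hij
      refine hP.homVanishes_bimoduleTensor (i := i) (fun k hk => ?_)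
        (isFiniteLength_iff_isNoetherian_isArtinian.mpr ⟨inferInstance, inferInstance⟩)
        (fun k hk => ?_)
      · exact (hP.compositionMultiplicity_eq_zero_iff j).mp (h k j (hk.trans_lt hij))
      · have := hP.projective k
        exact homVanishes_standardModule_of_lt hk
    exact
      { hom_eq_zero := fun i j hij =>
          (key i j hij).of_surjective_source _ (Submodule.mkQ_surjective _)
        ext_eq_zero := fun i j hij =>
          hP.extOneVanishes_standardModule fun k hk => key i k (hij.trans_lt hk) }
  · have := hP.projective j
    have := hP.nontrivial i
    rw [hP.compositionMultiplicity_eq_zero_iff]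
    -- The trace lies in the radical, so `Δ(i)` surjects onto `S(i)`.
    have hle := (hP.isHollowModule i).le_jacobson (hP.traceSubmodule_ne_top i)
    exact (homVanishes_of_standardModule (h.hom_eq_zero i) j hij).of_surjective
      (BimoduleTensor.map _ (Submodule.factor hle))
      (BimoduleTensor.map_surjective _ (Submodule.factor_surjective hle))
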